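/- Let $q$ be a prime power, $s\ge 2$ an integer, and $u$ a positive divisor of $\frac{q^s-1}{q-1}$. Let $\mathcal X_u\subset\mathbb F_{q^s}^2$ be the set of $\mathbb F_{q^s}$-rational points of the affine curve $x^u=y^{q^{s-1}}+y^{q^{s-2}}+\cdots+y^q+y$, and let $\mathrm{ev}\colon\mathbb F_{q^s}[x,y]\to\mathbb F_{q^s}^{\mathcal X_u}$, $f\mapsto (f(P))_{P\in\mathcal X_u}$. Order the monomials by $$x^ay^b<x^{a'}y^{b'}\iff w(x^ay^b)<w(x^{a'}y^{b'}),\ \text{or } w(x^ay^b)=w(x^{a'}y^{b'})\text{ and } b<b',\qquad w(x^ay^b)=aq^{s-1}+ub,$$ write $\mathrm{in}(f)$ for the largest monomial occurring in a nonzero polynomial $f$, and for $A\subset\mathbb F_{q^s}[x,y]$ let $\Delta(A)$ be the set of monomials not contained in the initial ideal $(\mathrm{in}(f): f\in (A)\setminus\{0\})$ of the ideal $(A)$ generated by $A$ (for a set $A$ of monomials, $\Delta(A)$ is the set of monomials divisible by no element of $A$). For a finite nonempty set $M$ of monomials, let $a_1$ be the smallest exponent of $x$ occurring among the elements of $M$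 and put $$\Delta^*(M)=\Delta\bigl(\{y^{q^{s-1}},\,x^{\min\{a_1+u,\;u(q-1)+1\}}\}\cup M\bigr).$$ A set of monomials is decreasing if it contains every monomial dividing one of its elements. For a set $\mathcal M$ of monomials let $\mathcal L(\mathcal M)$ be its $\mathbb F_{q^s}$-linear span and $\mathrm{ev}(\mathcal M)=\mathrm{ev}(\mathcal L(\mathcal M))$. For linear codes $C'\subset C$ over $\mathbb F_{q^s}$ and $1\le r\le\dim C-\dim C'$, the $r$-th relative generalized Hamming weight is $$M_r(C,C')=\min\{|\mathrm{supp}(D)| : D\subset C \text{ a linear subcode},\ \dim D=r,\ D\cap C'=\{0\}\},$$ where $\mathrm{supp}(D)$ is the set of positions at which some codeword of $D$ is nonzero. **Theorem.** Let $\mathcal M_2\subset\mathcal M_1\subset\Delta(y^{q^{s-1}},x^{u(q-1)+1})$ be decreasing sets of monomials and let $1\le r\le|\mathcal M_1|-|\mathcal M_2|$. Then $M_r(\mathrm{ev}(\mathcal M_1),\mathrm{ev}(\mathcal M_2))$ is well defined (its defining minimum is over a nonempty set), the maximum below exists, and $$M_r(\mathrm{ev}(\mathcal M_1),\mathrm{ev}(\mathcal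 M_2))\ \ge\ |\mathcal X_u|-\max\{|\Delta^*(M)| : M\subset\{\mathrm{in}(f): f\in\mathcal L(\mathcal M_1)\setminus\mathcal L(\mathcal M_2)\},\ |M|=r\}.$$ Moreover, if every monomial of $\mathcal M_1\setminus\mathcal M_2$ is larger than every monomial of $\mathcal M_2$, then $$M_r(\mathrm{ev}(\mathcal M_1),\mathrm{ev}(\mathcal M_2))\ =\ |\mathcal X_u|-\max\{|\Delta^*(M)| : M\subset\mathcal M_1\setminus\mathcal M_2,\ |M|=r\},$$ where again the maximum exists. -/

import Mathlib

/-! Monomials `x^a y^b` are identified with their exponent vectors `m : Fin 2 →₀ ℕ`, where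
`m 0 = a` is the exponent of `x` and `m 1 = b` the exponent of `y`; divisibility of monomials is
the pointwise order `≤`, so a set of monomials is decreasing iff it is an `IsLowerSet`. -/

namespace NormTrace

open MvPolynomial

/-- The weight `w(x^a y^b) = a q^(s-1) + u b`. -/
def weight (q s u : ℕ) (m : Fin 2 →₀ ℕ) : ℕ := m 0 * q ^ (s - 1) + u * m 1

/-- The strict weighted degree lexicographic order on monomials: compare weights first, and
break ties by the exponent of `y`. -/
def MonLT (q s u : ℕ) (m m' : Fin 2 →₀ ℕ) : Prop :=
  weight q s u m < weight q s u m' ∨ (weight q s u m = weight q s u m' ∧ m 1 < m' 1)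

section Polynomials

variable {K : Type*} [Field K]

/-- `m` is the initial (leading) monomial of `f`: it occurs in `f`, and every other monomial that
occurs in `f` is smaller. (No `m` is the initial monomial of `0`.) -/
def IsInitial (q s u : ℕ) (f : MvPolynomial (Fin 2) K) (m : Fin 2 →₀ ℕ) : Prop :=
  m ∈ f.support ∧ ∀ m' ∈ f.support, m' ≠ m → MonLT q s u m' m

variable (K) in
/-- A set of exponent vectors as a set of monomials in `K[x,y]`. -/
def monomials (M : Set (Fin 2 →₀ ℕ)) : Set (MvPolynomial (Fin 2) K) :=
  (fun m => monomial m (1 : K)) '' M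

/-- The initial ideal of an ideal `I` of `K[x,y]`. -/
noncomputable def initialIdeal (q s u : ℕ) (I : Ideal (MvPolynomial (Fin 2) K)) :
    Ideal (MvPolynomial (Fin 2) K) :=
  Ideal.span (monomials K {m | ∃ f ∈ I, IsInitial q s u f m})

/-- The footprint `Δ(A)` of the ideal generated by `A`: the monomials outside its initial ideal. -/
def footprint (q s u : ℕ) (A : Set (MvPolynomial (Fin 2) K)) : Set (Fin 2 →₀ ℕ) :=
  {m | monomial m (1 : K) ∉ initialIdeal q s u (Ideal.span A)}

variable (K) in
/-- The box `Δ(y^(q^(s-1)), x^(u(q-1)+1))`. -/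
def box (q s u : ℕ) : Set (Fin 2 →₀ ℕ) :=
  footprint q s u {(X 1 : MvPolynomial (Fin 2) K) ^ q ^ (s - 1), X 0 ^ (u * (q - 1) + 1)}

variable (K) in
/-- `Δ*(M) = Δ({y^(q^(s-1)), x^(min(a₁ + u, u(q-1)+1))} ∪ M)` for a nonempty set of monomials `M`,
where `a₁` is the smallest exponent of `x` in `M`. -/
noncomputable def deltaStar (q s u : ℕ) (M : Set (Fin 2 →₀ ℕ)) : Set (Fin 2 →₀ ℕ) :=
  footprint q s u
    ({(X 1 : MvPolynomial (Fin 2) K) ^ q ^ (s - 1),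
      X 0 ^ min (sInf ((fun m => m 0) '' M) + u) (u * (q - 1) + 1)} ∪ monomials K M)

variable (K) in
/-- `L(M)`, the subspace of `K[x,y]` generated by the monomials in `M`. -/
noncomputable def polySpan (M : Set (Fin 2 →₀ ℕ)) : Submodule K (MvPolynomial (Fin 2) K) :=
  Submodule.span K (monomials K M)

variable (K) in
/-- The `K`-rational points of the curve `x^u = y^(q^(s-1)) + ⋯ + y^q + y`. -/
def curve (q s u : ℕ) : Set (K × K) :=
  {P | P.1 ^ u = ∑ i ∈ Finset.range s, P.2 ^ q ^ i}

variable (K) in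
/-- The evaluation map `f ↦ (f(P))` at the rational points `P` of the curve. -/
noncomputable def ev (q s u : ℕ) : MvPolynomial (Fin 2) K →ₗ[K] (curve K q s u → K) :=
  LinearMap.pi fun P => (aeval (R := K) ![P.1.1, P.1.2]).toLinearMap

variable (K) in
/-- The code `ev(M)`, the image of `L(M)` under the evaluation map. -/
noncomputable def code (q s u : ℕ) (M : Set (Fin 2 →₀ ℕ)) : Submodule K (curve K q s u → K) :=
  (polySpan K M).map (ev K q s u)

end Polynomials

section Codes

variable {K ι : Type*} [Field K]

/-- The support of a code: the positions at which some codeword is nonzero. -/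
def codeSupport (D : Submodule K (ι → K)) : Set ι := {i | ∃ c ∈ D, c i ≠ 0}

/-- The support sizes of the `r`-dimensional subcodes `D` of `C` with `D ∩ C' = {0}`. -/
def relSupportSizes (C C' : Submodule K (ι → K)) (r : ℕ) : Set ℕ :=
  {k | ∃ D : Submodule K (ι → K), D ≤ C ∧ Module.finrank K D = r ∧ D ⊓ C' = ⊥ ∧
    (codeSupport D).ncard = k}

/-- The `r`-th relative generalized Hamming weight `M_r(C, C')`. -/
noncomputable def relGHW (C C' : Submodule K (ι → K)) (r : ℕ) : ℕ := sInf (relSupportSizes C C' r)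

end Codes

variable (K : Type*) [Field K] in
/-- The initial monomials of the polynomials in `L(M₁) \ L(M₂)`. -/
def relInitials (q s u : ℕ) (M₁ M₂ : Set (Fin 2 →₀ ℕ)) : Set (Fin 2 →₀ ℕ) :=
  {m | ∃ f, f ∈ polySpan K M₁ ∧ f ∉ polySpan K M₂ ∧ IsInitial q s u f m}

variable (K : Type*) [Field K] in
/-- The numbers `|Δ*(M)|` for the subsets `M` of `S` with `r` elements (`r ≥ 1`). -/
def deltaStarSizes (q s u : ℕ) (S : Set (Fin 2 →₀ ℕ)) (r : ℕ) : Set ℕ :=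
  {k | ∃ M ⊆ S, M.ncard = r ∧ (deltaStar K q s u M).ncard = k}

end NormTrace

namespace NormTrace

open MvPolynomial

/-! ### The monomial order. -/

section Order

variable {q s u : ℕ}

/-! Write N = q^(s-1). A point of the curve has x^u equal to a trace, so x^u lies in the subfield of
q elements. This leaves u(q-1)+1 abscissas, each with a trace fibre of N ordinates, so there are at
least as many points as monomials in the box. Conversely, reduction by the curve polynomial and by
x^(u(q-1)+1) - x shows that the box spans all functions on the curve. Hence `ev` is injective on the
span of the box (`disjoint_polySpan_box_ker_ev`), and subcodes can be studied through polynomials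
and their initial monomials.

Lower bound: the polynomials in L(M₁) evaluating into an r-dimensional D have at least r initial
monomials. Choose a set M of r of them and let V be the common zeros of D. By the footprint bound,
|V| is at most the number of monomials divisible by no initial monomial of the ideal of V. Besides M
and the two monomials bounding the box, that ideal has one more initial monomial: cancelling x^a y^N
between a multiple of f, with initial monomial x^a y^b, and a multiple of the curve polynomial
leaves x^(a+u) in front (`exists_initial_X_pow_add`). Taking a minimal gives |V| ≤ |Δ*(M)|.

Sharpness: number the abscissas so that x_i^u = 1 for every index i of the box with a₁ ≤ i < a₁+u.
These abscissas share one trace fibre, so products of linear factors x - x_i and y - y_j, one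
product for each monomial of M, vanish together at |Δ*(M)| points (`exists_polynomials_with_zeros`).
Their values span a subcode attaining the bound; the hypothesis on the order serves to identify the
possible initial monomials with M₁ \ M₂. -/

theorem MonLT.trans {a b c : Fin 2 →₀ ℕ} (h : MonLT q s u a b) (h' : MonLT q s u b c) :
    MonLT q s u a c := by
  unfold MonLT at *
  omega

theorem MonLT.irrefl (a : Fin 2 →₀ ℕ) : ¬ MonLT q s u a a := by
  unfold MonLT
  omega

theorem MonLT.add_left {a b : Fin 2 →₀ ℕ} (h : MonLT q s u a b) (c : Fin 2 →₀ ℕ) :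
    MonLT q s u (c + a) (c + b) := by
  have e (a : Fin 2 →₀ ℕ) : weight q s u (c + a) = weight q s u c + weight q s u a := by
    simp only [weight, Finsupp.add_apply]
    ring
  unfold MonLT at *
  simp only [e, Finsupp.add_apply]
  omega

theorem MonLT.trichotomy (hq : 0 < q) (a b : Fin 2 →₀ ℕ) :
    MonLT q s u a b ∨ a = b ∨ MonLT q s u b a := by
  by_cases hw : weight q s u a = weight q s u b
  · by_cases h1 : a 1 = b 1
    · right; left
      have h0 : a 0 = b 0 := by
        have := hw
        simp only [weight, h1] at this
        exact Nat.eq_of_mul_eq_mul_right (pow_pos hq (s - 1)) (Nat.add_right_cancel this)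
      ext i
      fin_cases i <;> assumption
    · unfold MonLT
      omega
  · unfold MonLT
    omega

theorem monLT_wellFounded : WellFounded (MonLT q s u) := by
  refine Subrelation.wf (r := InvImage (Prod.Lex (· < ·) (· < ·))
    fun m : Fin 2 →₀ ℕ => (weight q s u m, m 1)) ?_
    (InvImage.wf _ (WellFounded.prod_lex wellFounded_lt wellFounded_lt))
  rintro a b (h | ⟨h, h'⟩)
  · exact Prod.Lex.left _ _ h
  · change Prod.Lex _ _ (weight q s u a, a 1) (weight q s u b, b 1)
    rw [h]
    exact Prod.Lex.right _ h'

theorem exists_greatest_monomial (hq : 0 < q) (S : Finset (Fin 2 →₀ ℕ)) (hS : S.Nonempty) :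
    ∃ m ∈ S, ∀ m' ∈ S, m' ≠ m → MonLT q s u m' m := by
  induction hS using Finset.Nonempty.cons_induction with
  | singleton a => exact ⟨a, by simp, by simp⟩
  | cons a S ha hS ih =>
    obtain ⟨m, hm, hmax⟩ := ih
    rcases MonLT.trichotomy (s := s) (u := u) hq a m with h | h | h
    · refine ⟨m, by simp [hm], fun m' hm' hne => ?_⟩
      rcases Finset.mem_cons.1 hm' with rfl | h'
      · exact h
      · exact hmax _ h' hne
    · exact absurd (h ▸ hm) ha
    · refine ⟨a, by simp, fun m' hm' hne => ?_⟩
      rcases Finset.mem_cons.1 hm' with rfl | h'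
      · exact absurd rfl hne
      · rcases eq_or_ne m' m with rfl | h''
        · exact h
        · exact (hmax _ h' h'').trans h

end Order

/-! ### Initial monomials, division and the footprint bound. -/

section Initial

variable {K : Type*} [Field K] {q s u : ℕ}

theorem exists_isInitial (hq : 0 < q) {f : MvPolynomial (Fin 2) K} (hf : f ≠ 0) :
    ∃ m, IsInitial q s u f m :=
  exists_greatest_monomial hq f.support (by simpa using hf)

theorem isInitial_monomial (m : Fin 2 →₀ ℕ) {c : K} (hc : c ≠ 0) :
    IsInitial q s u (monomial m c) m := by
  classical
  constructor <;> simp [support_monomial, hc]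

theorem IsInitial.monomial_mul {f : MvPolynomial (Fin 2) K} {m : Fin 2 →₀ ℕ}
    (h : IsInitial q s u f m) (d : Fin 2 →₀ ℕ) :
    IsInitial q s u (monomial d 1 * f) (d + m) := by
  refine ⟨?_, fun m' hm' hne => ?_⟩
  · rw [mem_support_iff, coeff_monomial_mul, one_mul]
    exact mem_support_iff.1 h.1
  · rw [mem_support_iff, coeff_monomial_mul'] at hm'
    split_ifs at hm' with hd
    · obtain ⟨e, rfl⟩ := exists_add_of_le hd
      refine (h.2 e ?_ (by rintro rfl; exact hne rfl)).add_left d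
      simpa using hm'
    · exact absurd rfl hm'

theorem mem_polySpan {S : Set (Fin 2 →₀ ℕ)} {f : MvPolynomial (Fin 2) K} :
    f ∈ polySpan K S ↔ ↑f.support ⊆ S := by
  rw [polySpan, monomials, ← restrictSupport_eq_span, mem_restrictSupport_iff]

theorem monomial_mem_polySpan {S : Set (Fin 2 →₀ ℕ)} {m : Fin 2 →₀ ℕ} (hm : m ∈ S) :
    monomial m (1 : K) ∈ polySpan K S :=
  Submodule.subset_span ⟨m, hm, rfl⟩

/-- Every monomial of an element of a monomial ideal is itself in the ideal, so passing to initial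
monomials adds nothing and the order plays no role. -/
theorem footprint_monomials (S : Set (Fin 2 →₀ ℕ)) :
    footprint q s u (monomials K S) = {m | ∀ t ∈ S, ¬ t ≤ m} := by
  classical
  ext m
  simp only [footprint, initialIdeal, Set.mem_ofPred_eq, monomials, mem_ideal_span_monomial_image,
    support_monomial, one_ne_zero, if_false, Finset.mem_singleton, forall_eq]
  constructor
  · intro h t ht htm
    refine h ⟨t, ⟨monomial t 1, ?_, isInitial_monomial t one_ne_zero⟩, htm⟩
    simpa [support_monomial] using ⟨t, ht, le_rfl⟩
  · rintro h ⟨t, ⟨f, hf, hft⟩, htm⟩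
    obtain ⟨t', ht', hle⟩ := hf t hft.1
    exact h t' ht' (hle.trans htm)

theorem X_pow_eq (i : Fin 2) (n : ℕ) :
    (X i : MvPolynomial (Fin 2) K) ^ n = monomial (Finsupp.single i n) 1 :=
  X_pow_eq_monomial

variable (K) in
theorem mem_box {m : Fin 2 →₀ ℕ} :
    m ∈ box K q s u ↔ m 0 < u * (q - 1) + 1 ∧ m 1 < q ^ (s - 1) := by
  have : ({(X 1 : MvPolynomial (Fin 2) K) ^ q ^ (s - 1), X 0 ^ (u * (q - 1) + 1)} :
      Set (MvPolynomial (Fin 2) K)) =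
      monomials K {Finsupp.single 1 (q ^ (s - 1)), Finsupp.single 0 (u * (q - 1) + 1)} := by
    simp only [X_pow_eq, monomials, Set.image_pair]
  rw [box, this, footprint_monomials]
  simp only [Set.mem_ofPred_eq, Set.mem_insert_iff, Set.mem_singleton_iff, forall_eq_or_imp,
    forall_eq, Finsupp.single_le_iff, not_le]
  tauto

variable (K) in
theorem mem_deltaStar {M : Set (Fin 2 →₀ ℕ)} {m : Fin 2 →₀ ℕ} :
    m ∈ deltaStar K q s u M ↔ m 1 < q ^ (s - 1) ∧
      m 0 < min (sInf ((fun m => m 0) '' M) + u) (u * (q - 1) + 1) ∧ ∀ t ∈ M, ¬ t ≤ m := by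
  have (k : ℕ) : ({(X 1 : MvPolynomial (Fin 2) K) ^ q ^ (s - 1), X 0 ^ k} ∪ monomials K M :
      Set (MvPolynomial (Fin 2) K)) =
      monomials K ({Finsupp.single 1 (q ^ (s - 1)), Finsupp.single 0 k} ∪ M) := by
    simp only [X_pow_eq, monomials, Set.image_union, Set.image_pair]
  rw [deltaStar, this, footprint_monomials]
  simp only [Set.mem_ofPred_eq, Set.mem_union, Set.mem_insert_iff, Set.mem_singleton_iff,
    or_imp, forall_and, forall_eq, Finsupp.single_le_iff, not_le, and_assoc]

variable (K q s u) in
theorem deltaStar_subset_box (M : Set (Fin 2 →₀ ℕ)) : deltaStar K q s u M ⊆ box K q s u :=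
  fun _ hm => (mem_box K).2
    ⟨((mem_deltaStar K).1 hm).2.1.trans_le (min_le_right _ _), ((mem_deltaStar K).1 hm).1⟩

/-- The exponent vector of `x^a y^b`. -/
noncomputable def expVec (p : ℕ × ℕ) : Fin 2 →₀ ℕ :=
  Finsupp.single 0 p.1 + Finsupp.single 1 p.2

@[simp] theorem expVec_zero (p : ℕ × ℕ) : expVec p 0 = p.1 := by simp [expVec]

@[simp] theorem expVec_one (p : ℕ × ℕ) : expVec p 1 = p.2 := by simp [expVec]

theorem expVec_injective : Function.Injective expVec := fun p p' h =>
  Prod.ext (by simpa using DFunLike.congr_fun h 0) (by simpa using DFunLike.congr_fun h 1)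

theorem expVec_apply (m : Fin 2 →₀ ℕ) : expVec (m 0, m 1) = m := by
  ext i
  fin_cases i <;> simp

variable (K q s u) in
theorem box_eq_image :
    box K q s u = expVec '' (Set.Iio (u * (q - 1) + 1) ×ˢ Set.Iio (q ^ (s - 1))) := by
  ext m
  rw [mem_box]
  constructor
  · intro h
    exact ⟨(m 0, m 1), h, expVec_apply m⟩
  · rintro ⟨p, hp, rfl⟩
    simpa using hp

variable (K q s u) in
theorem box_finite : (box K q s u).Finite := by
  rw [box_eq_image]
  exact ((Set.finite_Iio _).prod (Set.finite_Iio _)).image _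

/-- Every polynomial is congruent, modulo an ideal `J`, to a combination of the monomials that no initial monomial of `J` divides. -/
theorem sup_polySpan_eq_top (J : Ideal (MvPolynomial (Fin 2) K))
    (S : Set (Fin 2 →₀ ℕ)) (hS : ∀ m ∉ S, ∃ g ∈ J, ∃ t, IsInitial q s u g t ∧ t ≤ m)
    (f : MvPolynomial (Fin 2) K) : ∃ g ∈ polySpan K S, f - g ∈ J := by
  have key : ∀ m : Fin 2 →₀ ℕ, ∃ g ∈ polySpan K S, monomial m (1 : K) - g ∈ J := by
    intro m
    induction m using (monLT_wellFounded (q := q) (s := s) (u := u)).induction with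
    | _ m ih =>
    by_cases hm : m ∈ S
    · exact ⟨_, monomial_mem_polySpan hm, by simp⟩
    obtain ⟨g, hg, t, ht, htm⟩ := hS m hm
    obtain ⟨d, rfl⟩ := exists_add_of_le htm
    have h := ht.monomial_mul d
    set p := monomial d 1 * g with hp
    have hpJ : p ∈ J := J.mul_mem_left _ hg
    rw [add_comm d t] at h
    have hc := mem_support_iff.1 h.1
    have ih' : ∀ m' : Fin 2 →₀ ℕ, ∃ g' ∈ polySpan K S,
        m' ∈ p.support.erase (t + d) → monomial m' (1 : K) - g' ∈ J := by
      intro m'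
      by_cases hm' : m' ∈ p.support.erase (t + d)
      · obtain ⟨g', h1, h2⟩ := ih m' (h.2 m' (Finset.mem_of_mem_erase hm')
          (Finset.ne_of_mem_erase hm'))
        exact ⟨g', h1, fun _ => h2⟩
      · exact ⟨0, zero_mem _, fun h => absurd h hm'⟩
    choose r hr hrJ using ih'
    -- Modulo `J`, solve `p` for its initial monomial; the other monomials of `p` are smaller and
    -- are replaced by their remainders from the induction.
    refine ⟨-((coeff (t + d) p)⁻¹ • ∑ m' ∈ p.support.erase (t + d), coeff m' p • r m'),
      neg_mem (Submodule.smul_mem _ _ (Submodule.sum_mem _ fun m' _ =>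
        Submodule.smul_mem _ _ (hr m'))), ?_⟩
    have e : monomial (t + d) (1 : K) -
        -((coeff (t + d) p)⁻¹ • ∑ m' ∈ p.support.erase (t + d), coeff m' p • r m') =
        (coeff (t + d) p)⁻¹ • (p - ∑ m' ∈ p.support.erase (t + d),
          coeff m' p • (monomial m' (1 : K) - r m')) := by
      have hsum : p = coeff (t + d) p • monomial (t + d) (1 : K) +
          ∑ m' ∈ p.support.erase (t + d), coeff m' p • monomial m' (1 : K) := by
        rw [Finset.add_sum_erase _ (fun m' => coeff m' p • monomial m' (1 : K)) h.1]
        simp only [smul_monomial, smul_eq_mul, mul_one]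
        exact (support_sum_monomial_coeff p).symm
      have hsum' := congrArg ((coeff (t + d) p)⁻¹ • ·) hsum
      simp only [smul_add, smul_smul, inv_mul_cancel₀ hc, one_smul] at hsum'
      simp only [smul_sub, Finset.sum_sub_distrib]
      rw [hsum']
      simp only [Finset.smul_sum, smul_smul]
      abel
    rw [e, smul_eq_C_mul]
    refine J.mul_mem_left _ (J.sub_mem hpJ (J.sum_mem fun m' hm' => ?_))
    rw [smul_eq_C_mul]
    exact J.mul_mem_left _ (hrJ m' hm')
  choose r hr hrJ using key
  refine ⟨∑ m ∈ f.support, coeff m f • r m,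
    Submodule.sum_mem _ fun m _ => Submodule.smul_mem _ _ (hr m), ?_⟩
  have e : f - ∑ m ∈ f.support, coeff m f • r m =
      ∑ m ∈ f.support, coeff m f • (monomial m (1 : K) - r m) := by
    simp only [smul_sub, Finset.sum_sub_distrib]
    congr 1
    simp only [smul_monomial, smul_eq_mul, mul_one]
    exact (support_sum_monomial_coeff f).symm
  rw [e]
  refine J.sum_mem fun m _ => ?_
  rw [smul_eq_C_mul]
  exact J.mul_mem_left _ (hrJ m)

/-- Evaluation of polynomials at the points of `V`. -/
noncomputable def evalOn (V : Set (K × K)) : MvPolynomial (Fin 2) K →ₗ[K] (V → K) :=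
  LinearMap.pi fun P => (aeval (R := K) ![P.1.1, P.1.2]).toLinearMap

theorem evalOn_apply (V : Set (K × K)) (f : MvPolynomial (Fin 2) K) (P : V) :
    evalOn V f P = aeval ![P.1.1, P.1.2] f := rfl

/-- Over a finite field every point of the plane has an indicator polynomial. -/
theorem evalOn_surjective [Fintype K] (V : Set (K × K)) :
    Function.Surjective (evalOn V) := by
  classical
  intro c
  refine ⟨∑ P : V, C (c P) * indicator ![P.1.1, P.1.2], ?_⟩
  funext P
  rw [evalOn_apply, aeval_eq_eval, map_sum, Finset.sum_eq_single P]
  · simp [eval_indicator_apply_eq_one]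
  · intro P' _ hne
    have : (![P.1.1, P.1.2] : Fin 2 → K) ≠ ![P'.1.1, P'.1.2] := by
      intro h
      exact hne (Subtype.ext (Prod.ext (congrFun h 0).symm (congrFun h 1).symm))
    rw [map_mul, eval_indicator_apply_eq_zero _ _ this, mul_zero]
  · simp

/-- The ideal of the polynomials that vanish on `V`. -/
noncomputable def idealOf (V : Set (K × K)) : Ideal (MvPolynomial (Fin 2) K) :=
  ⨅ P : V, RingHom.ker (aeval (R := K) ![P.1.1, P.1.2])

theorem mem_idealOf {V : Set (K × K)} {f : MvPolynomial (Fin 2) K} :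
    f ∈ idealOf V ↔ evalOn V f = 0 := by
  simp only [idealOf, Submodule.mem_iInf, RingHom.mem_ker, funext_iff, evalOn_apply,
    Pi.zero_apply]

/-- The footprint bound: the monomials not divisible by an initial monomial of the vanishing
ideal of `V` span the functions on `V`. -/
theorem span_evalOn_eq_top [Fintype K] (V : Set (K × K))
    (S : Set (Fin 2 →₀ ℕ))
    (hS : ∀ m ∉ S, ∃ g ∈ idealOf V, ∃ t, IsInitial q s u g t ∧ t ≤ m) :
    Submodule.span K (Set.range fun m : S => evalOn V (monomial m.1 (1 : K))) = ⊤ := by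
  have hspan : Submodule.span K (Set.range fun m : S => evalOn V (monomial m.1 (1 : K))) =
      (polySpan K S).map (evalOn V) := by
    rw [polySpan, Submodule.map_span, monomials, ← Set.image_comp, Set.image_eq_range]
    rfl
  rw [hspan, eq_top_iff]
  rintro c -
  obtain ⟨f, rfl⟩ := evalOn_surjective V c
  obtain ⟨g, hg, hfg⟩ := sup_polySpan_eq_top (s := s) (u := u) (idealOf V) S hS f
  refine ⟨g, hg, ?_⟩
  rw [mem_idealOf, map_sub, sub_eq_zero] at hfg
  exact hfg.symm

theorem ncard_le_of_footprint [Fintype K] (V : Set (K × K))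
    (S : Set (Fin 2 →₀ ℕ)) (hfin : S.Finite)
    (hS : ∀ m ∉ S, ∃ g ∈ idealOf V, ∃ t, IsInitial q s u g t ∧ t ≤ m) :
    V.ncard ≤ S.ncard := by
  classical
  have := hfin.fintype
  have h := finrank_range_le_card (R := K) (fun m : S => evalOn V (monomial m.1 (1 : K)))
  rw [Set.finrank, span_evalOn_eq_top V S hS, finrank_top,
    Module.finrank_fintype_fun_eq_card, ← Nat.card_eq_fintype_card,
    ← Nat.card_eq_fintype_card] at h
  exact h

end Initial

end NormTrace
namespace NormTrace

open MvPolynomial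

/-! ### Trace fibres, roots of unity and enumerations of the points. -/

section Counting

theorem mul_dvd_pow_sub_one {q s u : ℕ} (hdvd : u ∣ (q ^ s - 1) / (q - 1)) :
    u * (q - 1) ∣ q ^ s - 1 := by
  have h : q - 1 ∣ q ^ s - 1 := Nat.sub_one_dvd_pow_sub_one q s
  obtain ⟨d, hd⟩ := hdvd
  refine ⟨d, ?_⟩
  rw [← Nat.div_mul_cancel h, hd]
  ring

variable {K : Type*} [Field K] [Fintype K] {q s u : ℕ}

/-- The q-th power is additive and shifts the summands cyclically, since y^(q^s) = y. -/
theorem trace_pow_card (hq : IsPrimePow q) (hs : s ≠ 0) (hK : Fintype.card K = q ^ s) (y : K) :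
    (∑ i ∈ Finset.range s, y ^ q ^ i) ^ q = ∑ i ∈ Finset.range s, y ^ q ^ i := by
  have hpow : (∑ i ∈ Finset.range s, y ^ q ^ i) ^ q = ∑ i ∈ Finset.range s, (y ^ q ^ i) ^ q := by
    obtain ⟨p, k, hp, hk, rfl⟩ := hq
    have := Fact.mk hp.nat_prime
    have : CharP K p := by
      refine charP_of_card_eq_prime_pow (f := k * s) ?_
      rw [hK, pow_mul]
    exact sum_pow_char_pow _ _ _ _
  obtain ⟨s, rfl⟩ := Nat.exists_eq_succ_of_ne_zero hs
  rw [hpow]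
  simp only [← pow_mul, ← pow_succ]
  rw [Finset.sum_range_succ, Finset.sum_range_succ', ← hK, FiniteField.pow_card]
  simp

theorem card_trace_fiber_le (hq : 1 < q) (hs : s ≠ 0) [DecidableEq K] (c : K) :
    (Finset.univ.filter fun y : K => ∑ i ∈ Finset.range s, y ^ q ^ i = c).card ≤ q ^ (s - 1) := by
  obtain ⟨s, rfl⟩ := Nat.exists_eq_succ_of_ne_zero hs
  let P : Polynomial K :=
    Polynomial.X ^ q ^ s + (∑ i ∈ Finset.range s, Polynomial.X ^ q ^ i - Polynomial.C c)
  have hlow : (∑ i ∈ Finset.range s, Polynomial.X ^ q ^ i - Polynomial.C c : Polynomial K).degree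
      < (q ^ s : ℕ) := by
    refine (Polynomial.degree_sub_le _ _).trans_lt (max_lt ?_ ?_)
    · refine (Polynomial.degree_sum_le _ _).trans_lt ((Finset.sup_lt_iff ?_).2 fun i hi => ?_)
      · exact WithBot.bot_lt_coe _
      · rw [Polynomial.degree_X_pow]
        exact_mod_cast Nat.pow_lt_pow_right hq (Finset.mem_range.1 hi)
    · exact Polynomial.degree_C_le.trans_lt (by exact_mod_cast pow_pos (by omega) s)
  have hdeg : P.natDegree = q ^ s := by
    refine Polynomial.natDegree_eq_of_degree_eq_some ?_
    rw [Polynomial.degree_add_eq_left_of_degree_lt] <;> rw [Polynomial.degree_X_pow]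
    exact hlow
  have hP : P ≠ 0 := by
    rintro h
    rw [h, Polynomial.natDegree_zero] at hdeg
    exact absurd hdeg.symm (pow_pos (by omega) s).ne'
  rw [Nat.succ_sub_one, ← hdeg]
  refine Polynomial.card_le_degree_of_subset_roots fun y hy => ?_
  rw [Polynomial.mem_roots hP, Polynomial.IsRoot.def]
  have := (Finset.mem_filter.1 hy).2
  rw [Finset.sum_range_succ] at this
  simp [P, Polynomial.eval_finsetSum, ← this]

theorem card_pow_eq_self_le (hq : 1 < q) [DecidableEq K] :
    (Finset.univ.filter fun c : K => c ^ q = c).card ≤ q := by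
  have hP := FiniteField.X_pow_card_sub_X_ne_zero K hq
  conv_rhs => rw [← FiniteField.X_pow_card_sub_X_natDegree_eq K hq]
  refine Polynomial.card_le_degree_of_subset_roots fun y hy => ?_
  rw [Polynomial.mem_roots hP, Polynomial.IsRoot.def]
  simp [(Finset.mem_filter.1 hy).2]

/-- The fibers of the trace over the elements of the subfield with `q` elements have `q^(s-1)`
elements. -/
theorem card_trace_fiber (hq : IsPrimePow q) (hs : s ≠ 0) (hK : Fintype.card K = q ^ s)
    [DecidableEq K] {c : K} (hc : c ^ q = c) :
    (Finset.univ.filter fun y : K => ∑ i ∈ Finset.range s, y ^ q ^ i = c).card = q ^ (s - 1) := by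
  refine (card_trace_fiber_le hq.one_lt hs c).antisymm ?_
  -- Pigeonhole: at most q fibres cover the q^s elements and none exceeds q^(s-1), so the other q -
  -- 1 fibres leave at least q^(s-1) elements for this one.
  have hsum := Finset.card_eq_sum_card_fiberwise (s := (Finset.univ : Finset K))
    (t := Finset.univ.filter fun c : K => c ^ q = c)
    (f := fun y => ∑ i ∈ Finset.range s, y ^ q ^ i)
    (fun y _ => by simpa using trace_pow_card hq hs hK y)
  rw [Finset.card_univ, hK, ← Finset.add_sum_erase _ _
    (show c ∈ Finset.univ.filter fun c : K => c ^ q = c by simpa using hc)] at hsum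
  have hle := Finset.sum_le_card_nsmul ((Finset.univ.filter fun c : K => c ^ q = c).erase c)
    (fun c => (Finset.univ.filter fun y : K => ∑ i ∈ Finset.range s, y ^ q ^ i = c).card)
    _ fun c _ => card_trace_fiber_le hq.one_lt hs c
  have hcard : ((Finset.univ.filter fun c : K => c ^ q = c).erase c).card ≤ q - 1 := by
    rw [Finset.card_erase_of_mem (by simpa using hc)]
    exact Nat.sub_le_sub_right (card_pow_eq_self_le hq.one_lt) 1
  have hle' := hle.trans (Nat.mul_le_mul_right (q ^ (s - 1)) hcard)
  have e : q ^ s = q ^ (s - 1) + (q - 1) * q ^ (s - 1) := by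
    obtain ⟨s, rfl⟩ := Nat.exists_eq_succ_of_ne_zero hs
    obtain ⟨q, rfl⟩ := Nat.exists_eq_succ_of_ne_zero hq.ne_zero
    simp only [Nat.succ_eq_add_one, Nat.add_sub_cancel]
    ring
  omega

theorem card_rootsOfUnity_eq [DecidableEq K] {n : ℕ} (hn : n ∣ Fintype.card K - 1) :
    (Finset.univ.filter fun x : K => x ^ n = 1).card = n := by
  have h1 : 0 < Fintype.card K - 1 := Nat.sub_pos_of_lt Fintype.one_lt_card
  have hn0 : 0 < n := Nat.pos_of_dvd_of_pos hn h1
  obtain ⟨g, hg⟩ := IsCyclic.exists_generator (α := Kˣ)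
  have hord : orderOf g = Fintype.card K - 1 := by
    rw [orderOf_eq_card_of_forall_mem_zpowers hg, Nat.card_eq_fintype_card, Fintype.card_units]
  obtain ⟨d, hd⟩ := hn
  have hprim : IsPrimitiveRoot ((g : K) ^ d) n := by
    have : IsPrimitiveRoot (g : K) (Fintype.card K - 1) := by
      rw [← hord]
      exact IsPrimitiveRoot.coe_units_iff.2 (IsPrimitiveRoot.orderOf g)
    exact this.pow h1 (by rw [hd, mul_comm])
  conv_rhs => rw [← hprim.card_nthRootsFinset]
  congr 1
  ext x
  simp [Polynomial.mem_nthRootsFinset hn0]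

/-- An enumeration of each fiber of the trace. -/
theorem exists_trace_fiber_enum (hq : IsPrimePow q) (hs : s ≠ 0) (hK : Fintype.card K = q ^ s) :
    ∃ y : K → ℕ → K, ∀ c, c ^ q = c → Set.InjOn (y c) (Set.Iio (q ^ (s - 1))) ∧
      ∀ j < q ^ (s - 1), ∑ i ∈ Finset.range s, y c j ^ q ^ i = c := by
  classical
  have key : ∀ c : K, ∃ y : ℕ → K, c ^ q = c → Set.InjOn y (Set.Iio (q ^ (s - 1))) ∧
      ∀ j < q ^ (s - 1), ∑ i ∈ Finset.range s, y j ^ q ^ i = c := by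
    intro c
    by_cases hc : c ^ q = c
    · have e := Finset.equivFinOfCardEq (card_trace_fiber hq hs hK hc)
      refine ⟨fun j => if h : j < q ^ (s - 1) then e.symm ⟨j, h⟩ else 0, fun _ => ⟨?_, ?_⟩⟩
      · intro i hi j hj hij
        simp only [dif_pos (Set.mem_Iio.1 hi), dif_pos (Set.mem_Iio.1 hj)] at hij
        simpa using e.symm.injective (Subtype.ext hij)
      · intro j hj
        simp only [dif_pos hj]
        exact (Finset.mem_filter.1 (e.symm ⟨j, hj⟩).2).2
    · exact ⟨fun _ => 0, fun h => absurd h hc⟩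
  choose y hy using key
  exact ⟨y, hy⟩

/-- An enumeration of the `x` with `x^u` in the subfield with `q` elements, in which `x^u = 1`
for the indices in `[a, a + u)`. -/
theorem exists_abscissa_enum (hq : 1 < q) (hK : Fintype.card K = q ^ s)
    (hu : 0 < u) (hdvd : u ∣ (q ^ s - 1) / (q - 1)) (a : ℕ) :
    ∃ x : ℕ → K, Set.InjOn x (Set.Iio (u * (q - 1) + 1)) ∧
      (∀ i < u * (q - 1) + 1, (x i ^ u) ^ q = x i ^ u) ∧
      ∀ i, a ≤ i → i < min (a + u) (u * (q - 1) + 1) → x i ^ u = 1 := by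
  classical
  have hdvd' := mul_dvd_pow_sub_one hdvd
  rw [← hK] at hdvd'
  set n := u * (q - 1) with hn
  have hn0 : n ≠ 0 := (Nat.mul_pos hu (by omega)).ne'
  have hpow (w : K) : w ^ n = (w ^ u) ^ (q - 1) := by rw [hn, pow_mul]
  -- The abscissas: x^u is fixed by the q-th power exactly when x = 0 or x^(u(q-1)) = 1.
  let t : Finset K := insert 0 (Finset.univ.filter fun x : K => x ^ n = 1)
  have ht : t.card = n + 1 := by
    rw [Finset.card_insert_of_notMem (by simp [hn0]), card_rootsOfUnity_eq hdvd']
  have e := Finset.equivFinOfCardEq (card_rootsOfUnity_eq (K := K)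
    ((Dvd.intro _ rfl : u ∣ n).trans hdvd'))
  let z : ℕ → K := fun j => if h : j < u then e.symm ⟨j, h⟩ else 0
  have hz (j : ℕ) (hj : j < u) : z j ^ u = 1 := by
    simp only [z, dif_pos hj]
    exact (Finset.mem_filter.1 (e.symm ⟨j, hj⟩).2).2
  -- The window may be cut off at n + 1. The u-th roots of unity are injected on it, and this
  -- partial numbering extends to a bijection onto all abscissas.
  let S : Finset (Fin (n + 1)) := Finset.univ.filter fun i => a ≤ i.1 ∧ i.1 < a + u
  obtain ⟨g, hg⟩ := Finset.exists_equiv_extend_of_card_eq (α := Fin (n + 1)) (t := t)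
    (by rw [Fintype.card_fin, ht]) (s := S) (f := fun i => z (i.1 - a))
    (by
      intro x hx
      obtain ⟨i, hi, rfl⟩ := Finset.mem_image.1 hx
      have := (Finset.mem_filter.1 hi).2
      refine Finset.mem_insert_of_mem (Finset.mem_filter.2 ⟨Finset.mem_univ _, ?_⟩)
      rw [hpow, hz _ (by omega), one_pow])
    (by
      intro i hi j hj hij
      have h1 := (Finset.mem_filter.1 hi).2
      have h2 := (Finset.mem_filter.1 hj).2
      simp only [z, dif_pos (show i.1 - a < u by omega), dif_pos (show j.1 - a < u by omega)]
        at hij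
      have := e.symm.injective (Subtype.ext hij)
      simp only [Fin.mk.injEq] at this
      exact Fin.ext (by omega))
  refine ⟨fun i => if h : i < n + 1 then g ⟨i, h⟩ else 0, ?_, ?_, ?_⟩
  · intro i hi j hj hij
    simp only [dif_pos (Set.mem_Iio.1 hi), dif_pos (Set.mem_Iio.1 hj)] at hij
    simpa using g.injective (Subtype.ext hij)
  · intro i hi
    simp only [dif_pos hi]
    rcases Finset.mem_insert.1 (g ⟨i, hi⟩).2 with h | h
    · rw [h, zero_pow hu.ne', zero_pow (by omega)]
    · have h' := (Finset.mem_filter.1 h).2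
      rw [hpow] at h'
      rw [← pow_sub_one_mul (by omega : q ≠ 0), h', one_mul]
  · intro i hi hi'
    have hi'' : i < n + 1 := hi'.trans_le (min_le_right _ _)
    have hi3 := hi'.trans_le (min_le_left _ _)
    simp only [dif_pos hi'']
    rw [hg ⟨i, hi''⟩ (Finset.mem_filter.2 ⟨Finset.mem_univ _, hi, hi3⟩)]
    exact hz _ (by simp only; omega)

/-- The number of points of the curve is at least (in fact equal to) the size of the box. -/
theorem ncard_box_le_ncard_curve (hq : IsPrimePow q) (hs : s ≠ 0) (hK : Fintype.card K = q ^ s)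
    (hu : 0 < u) (hdvd : u ∣ (q ^ s - 1) / (q - 1)) :
    (box K q s u).ncard ≤ (curve K q s u).ncard := by
  obtain ⟨x, hx, hxq, -⟩ := exists_abscissa_enum hq.one_lt hK hu hdvd 0
  obtain ⟨y, hy⟩ := exists_trace_fiber_enum hq hs hK
  refine Set.ncard_le_ncard_of_injOn (fun m => (x (m 0), y (x (m 0) ^ u) (m 1))) ?_ ?_
    (Set.toFinite _)
  · intro m hm
    rw [mem_box] at hm
    exact ((hy _ (hxq _ hm.1)).2 _ hm.2).symm
  · intro m hm m' hm' h
    rw [mem_box] at hm hm'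
    obtain ⟨h0, h1⟩ := Prod.mk.inj h
    have e0 := hx hm.1 hm'.1 h0
    rw [e0] at h1
    have e1 := (hy _ (hxq _ hm'.1)).1 hm.2 hm'.2 h1
    ext i
    fin_cases i <;> assumption

end Counting

end NormTrace
namespace NormTrace

open MvPolynomial

/-! ### Initial monomials of sums and products. -/

section Lower

variable {K : Type*} [Field K] {q s u : ℕ}

theorem IsInitial.add_lower {f g : MvPolynomial (Fin 2) K} {m : Fin 2 →₀ ℕ}
    (hf : IsInitial q s u f m) (hg : g ∈ polySpan K {m' | MonLT q s u m' m}) :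
    IsInitial q s u (f + g) m := by
  classical
  rw [mem_polySpan] at hg
  refine ⟨?_, fun m' hm' hne => ?_⟩
  · have : coeff m g = 0 := notMem_support_iff.1 fun h => MonLT.irrefl m (hg h)
    rw [mem_support_iff, coeff_add, this, add_zero]
    exact mem_support_iff.1 hf.1
  · rcases Finset.mem_union.1 (support_add hm') with h | h
    · exact hf.2 _ h hne
    · exact hg h

theorem IsInitial.smul {f : MvPolynomial (Fin 2) K} {m : Fin 2 →₀ ℕ}
    (hf : IsInitial q s u f m) {c : K} (hc : c ≠ 0) : IsInitial q s u (c • f) m := by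
  rw [IsInitial, support_smul_eq hc]
  exact hf

theorem IsInitial.ne_zero {f : MvPolynomial (Fin 2) K} {m : Fin 2 →₀ ℕ}
    (hf : IsInitial q s u f m) : f ≠ 0 := by
  rintro rfl
  simpa using hf.1

theorem IsInitial.mem_polySpan_of_lt {f : MvPolynomial (Fin 2) K} {m m' : Fin 2 →₀ ℕ}
    (hf : IsInitial q s u f m) (h : MonLT q s u m m') :
    f ∈ polySpan K {m'' | MonLT q s u m'' m'} := by
  rw [mem_polySpan]
  intro m'' hm''
  rcases eq_or_ne m'' m with rfl | hne
  · exact h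
  · exact (hf.2 _ hm'' hne).trans h

theorem polySpan_mono {S T : Set (Fin 2 →₀ ℕ)} (h : S ⊆ T) : polySpan K S ≤ polySpan K T :=
  Submodule.span_mono (Set.image_mono h)

theorem monomial_mul_mem_polySpan {S T : Set (Fin 2 →₀ ℕ)} {f : MvPolynomial (Fin 2) K}
    (hf : f ∈ polySpan K S) {d : Fin 2 →₀ ℕ} (h : ∀ m ∈ S, d + m ∈ T) (c : K) :
    monomial d c * f ∈ polySpan K T := by
  rw [mem_polySpan] at *
  intro m' hm'
  rw [Finset.mem_coe, mem_support_iff, coeff_monomial_mul'] at hm'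
  split_ifs at hm' with hd
  · obtain ⟨e, rfl⟩ := exists_add_of_le hd
    refine h e (hf ?_)
    rw [add_tsub_cancel_left] at hm'
    exact mem_support_iff.2 (right_ne_zero_of_mul hm')
  · exact absurd rfl hm'

theorem sub_monomial_mem_polySpan {f : MvPolynomial (Fin 2) K} {m : Fin 2 →₀ ℕ}
    {S : Set (Fin 2 →₀ ℕ)} (h : ∀ m' ∈ f.support, m' ≠ m → m' ∈ S) :
    f - monomial m (coeff m f) ∈ polySpan K S := by
  classical
  rw [mem_polySpan]
  intro m' hm'
  rw [Finset.mem_coe, mem_support_iff, coeff_sub, coeff_monomial] at hm'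
  split_ifs at hm' with e
  · simp [e] at hm'
  · exact h m' (by simpa using hm') (Ne.symm e)

/-- The greatest index of a combination of polynomials with distinct initial monomials is its
initial monomial. -/
theorem exists_isInitial_sum (hq : 0 < q) {f : (Fin 2 →₀ ℕ) → MvPolynomial (Fin 2) K}
    (F : Finset (Fin 2 →₀ ℕ)) (hF : F.Nonempty) (hf : ∀ m ∈ F, IsInitial q s u (f m) m)
    {c : (Fin 2 →₀ ℕ) → K} (hc : ∀ m ∈ F, c m ≠ 0) :
    ∃ m ∈ F, IsInitial q s u (∑ m ∈ F, c m • f m) m := by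
  obtain ⟨m, hm, hmax⟩ := exists_greatest_monomial (s := s) (u := u) hq F hF
  refine ⟨m, hm, ?_⟩
  rw [← Finset.add_sum_erase _ _ hm]
  refine ((hf m hm).smul (hc m hm)).add_lower (Submodule.sum_mem _ fun m' hm' => ?_)
  have h := Finset.mem_of_mem_erase hm'
  exact Submodule.smul_mem _ _
    ((hf m' h).mem_polySpan_of_lt (hmax m' h (Finset.ne_of_mem_erase hm')))

/-- Reading off the coefficients at these monomials is injective: a nonzero polynomial has a nonzero
coefficient at its own initial monomial. -/
theorem finrank_le_ncard_initials (hq : 0 < q) (E : Submodule K (MvPolynomial (Fin 2) K))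
    (hfin : {m | ∃ f ∈ E, IsInitial q s u f m}.Finite) :
    Module.finrank K E ≤ {m | ∃ f ∈ E, IsInitial q s u f m}.ncard := by
  set T := {m | ∃ f ∈ E, IsInitial q s u f m} with hT
  have := hfin.fintype
  let φ : E →ₗ[K] (T → K) := LinearMap.pi fun t => (lcoeff K t.1).comp E.subtype
  have hφ : Function.Injective φ := by
    rw [← LinearMap.ker_eq_bot, LinearMap.ker_eq_bot']
    intro f hf
    by_contra hne
    obtain ⟨m, hm⟩ := exists_isInitial (s := s) (u := u) hq
      (f := f.1) (fun h => hne (Subtype.ext h))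
    exact mem_support_iff.1 hm.1 (congrFun hf ⟨m, f.1, f.2, hm⟩)
  have h := LinearMap.finrank_le_finrank_of_injective hφ
  rw [Module.finrank_fintype_fun_eq_card, ← Nat.card_eq_fintype_card] at h
  exact h

theorem monomial_eq_C_mul (m : Fin 2 →₀ ℕ) (c : K) :
    monomial m c = C c * (X 0 ^ m 0 * X 1 ^ m 1) := by
  rw [monomial_eq, Finsupp.prod_fintype _ _ (by simp), Fin.prod_univ_two]

theorem monLT_of_lt (hq : 0 < q) (hu : 0 < u) {m m' : Fin 2 →₀ ℕ} (h : m < m') :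
    MonLT q s u m m' := by
  have hN : 0 < q ^ (s - 1) := pow_pos hq _
  have h0 := h.le 0
  have h1 := h.le 1
  have a0 := Nat.mul_le_mul_right (q ^ (s - 1)) h0
  have a1 := Nat.mul_le_mul_left u h1
  left
  unfold weight
  rcases h0.lt_or_eq with h | h'
  · have := Nat.mul_lt_mul_of_pos_right h hN
    omega
  rcases h1.lt_or_eq with h | h''
  · have := Nat.mul_lt_mul_of_pos_left h hu
    omega
  · refine absurd ?_ h.ne
    ext i
    fin_cases i <;> assumption

/-- Multiplication by a linear factor preserves the property that all the monomials divide one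
of them, which has coefficient one. -/
theorem linear_factor_mul_sub_mem {f : MvPolynomial (Fin 2) K} {m : Fin 2 →₀ ℕ}
    (h : f - monomial m 1 ∈ polySpan K (Set.Iio m)) (i : Fin 2) (c : K) :
    (X i - C c) * f - monomial (Finsupp.single i 1 + m) 1 ∈
      polySpan K (Set.Iio (Finsupp.single i 1 + m)) := by
  have hlt : m < Finsupp.single i 1 + m := by
    refine lt_add_of_pos_left m (pos_of_ne_zero ?_)
    simp
  have e : (X i - C c) * f - monomial (Finsupp.single i 1 + m) 1 =
      monomial (Finsupp.single i 1) 1 * (f - monomial m 1) -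
        (c • (f - monomial m 1) + c • monomial m 1) := by
    rw [smul_eq_C_mul, smul_eq_C_mul, mul_sub (monomial _ _), monomial_mul, mul_one]
    change _ = X i * f - _ - _
    ring
  rw [e]
  refine sub_mem (monomial_mul_mem_polySpan h (fun m' hm' => ?_) 1)
    (add_mem (Submodule.smul_mem _ _ (polySpan_mono (Set.Iio_subset_Iio hlt.le) h))
      (Submodule.smul_mem _ _ (monomial_mem_polySpan hlt)))
  exact add_lt_add_right (Set.mem_Iio.1 hm') _

/-- Control by divisibility rather than by the order serves twice: it determines the initial
monomial and keeps the product inside the span of any decreasing set containing x^a y^b. -/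
theorem prod_linear_factors_sub_mem (x y : ℕ → K) (a b : ℕ) :
    (∏ i ∈ Finset.range a, (X 0 - C (x i))) * (∏ j ∈ Finset.range b, (X 1 - C (y j))) -
      monomial (Finsupp.single 0 a + Finsupp.single 1 b : Fin 2 →₀ ℕ) (1 : K) ∈
        polySpan K (Set.Iio (Finsupp.single 0 a + Finsupp.single 1 b)) := by
  induction a with
  | zero =>
    induction b with
    | zero => simp
    | succ b ih =>
      have := linear_factor_mul_sub_mem ih 1 (y b)
      rw [Finset.prod_range_succ]
      have e : (Finsupp.single 0 0 + Finsupp.single 1 (b + 1) : Fin 2 →₀ ℕ) =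
          Finsupp.single 1 1 + (Finsupp.single 0 0 + Finsupp.single 1 b) := by
        rw [add_left_comm, ← Finsupp.single_add, add_comm 1 b]
      rw [e]
      convert this using 2
      ring
  | succ a ih =>
    have := linear_factor_mul_sub_mem ih 0 (x a)
    rw [Finset.prod_range_succ]
    have e : (Finsupp.single 0 (a + 1) + Finsupp.single 1 b : Fin 2 →₀ ℕ) =
        Finsupp.single 0 1 + (Finsupp.single 0 a + Finsupp.single 1 b) := by
      rw [← add_assoc, ← Finsupp.single_add, add_comm 1 a]
    rw [e]
    convert this using 2
    ring

end Lower

/-! ### Initial monomials of ideals of subsets of the curve; injectivity of evaluation. -/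

section Curve

variable {K : Type*} [Field K] {q s u : ℕ}

/-- The witness is x^(u(q-1)+1) - x: on the curve x^u is a trace, hence fixed by the q-th power, so
x = 0 or x^(u(q-1)) = 1. -/
theorem exists_initial_X_pow [Fintype K] (hq : IsPrimePow q) (hs : s ≠ 0) (hK : Fintype.card K = q ^ s)
    (hu : 0 < u) {V : Set (K × K)} (hV : V ⊆ curve K q s u) :
    ∃ g ∈ idealOf V, IsInitial q s u g (Finsupp.single 0 (u * (q - 1) + 1)) := by
  have hq1 := hq.one_lt
  refine ⟨monomial (Finsupp.single 0 (u * (q - 1) + 1)) 1 + -monomial (Finsupp.single 0 1) 1, ?_,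
    (isInitial_monomial _ one_ne_zero).add_lower (neg_mem (monomial_mem_polySpan
      (monLT_of_lt hq.pos hu ?_)))⟩
  · rw [mem_idealOf]
    funext P
    have hP : P.1.1 ^ u = ∑ i ∈ Finset.range s, P.1.2 ^ q ^ i := hV P.2
    have h : (P.1.1 ^ u) ^ q = P.1.1 ^ u := by rw [hP, trace_pow_card hq hs hK]
    rw [← pow_sub_one_mul (by omega : q ≠ 0)] at h
    have h' : P.1.1 ^ (u * (q - 1) + 1) = P.1.1 := by
      by_cases h0 : P.1.1 = 0
      · simp [h0]
      · have := mul_right_cancel₀ (pow_ne_zero u h0) (h.trans (one_mul _).symm)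
        rw [pow_succ, pow_mul, this, one_mul]
    simp only [evalOn_apply, ← X_pow_eq, map_add, map_neg, map_pow, aeval_X]
    simpa [sub_eq_zero, ← sub_eq_add_neg] using h'
  · refine (Finsupp.single_mono (by omega)).lt_of_ne fun h => ?_
    have := Finsupp.single_injective _ h
    have := Nat.mul_pos hu (by omega : 0 < q - 1)
    omega

theorem curvePolynomial_mem {V : Set (K × K)} (hV : V ⊆ curve K q s u) :
    (∑ i ∈ Finset.range s, (X 1 : MvPolynomial (Fin 2) K) ^ q ^ i - X 0 ^ u) ∈ idealOf V := by
  rw [mem_idealOf]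
  funext P
  have hP : P.1.1 ^ u = ∑ i ∈ Finset.range s, P.1.2 ^ q ^ i := hV P.2
  simp [evalOn_apply, hP]

/-- In the curve polynomial, y^(q^(s-1)) and x^u have the same weight; the tie-break favours y. -/
theorem exists_initial_Y_pow (hq : 1 < q) (hs : s ≠ 0) (hu : 0 < u)
    {V : Set (K × K)} (hV : V ⊆ curve K q s u) :
    ∃ g ∈ idealOf V, IsInitial q s u g (Finsupp.single 1 (q ^ (s - 1))) := by
  refine ⟨_, curvePolynomial_mem hV, ?_⟩
  have h1 : 0 < q ^ (s - 1) := pow_pos (by omega) _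
  have e : (∑ i ∈ Finset.range s, (X 1 : MvPolynomial (Fin 2) K) ^ q ^ i - X 0 ^ u) =
      monomial (Finsupp.single 1 (q ^ (s - 1))) 1 +
        (∑ i ∈ Finset.range (s - 1), monomial (Finsupp.single 1 (q ^ i)) 1 -
          monomial (Finsupp.single 0 u) 1) := by
    obtain ⟨s, rfl⟩ := Nat.exists_eq_succ_of_ne_zero hs
    simp only [Finset.sum_range_succ, X_pow_eq, Nat.succ_eq_add_one, Nat.add_sub_cancel]
    ring
  rw [e]
  refine (isInitial_monomial _ one_ne_zero).add_lower
    (sub_mem (sum_mem fun i hi => monomial_mem_polySpan ?_) (monomial_mem_polySpan ?_))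
  · left
    have := Nat.mul_lt_mul_of_pos_left (Nat.pow_lt_pow_right hq (Finset.mem_range.1 hi)) hu
    simpa [weight] using this
  · right
    simp [weight, h1]

theorem coprime_pow (hq : 1 < q) (hs : s ≠ 0) (hdvd : u ∣ (q ^ s - 1) / (q - 1)) :
    Nat.Coprime u (q ^ (s - 1)) := by
  refine Nat.Coprime.pow_right _ (Nat.Coprime.coprime_dvd_left
    ((Dvd.intro _ rfl).trans (mul_dvd_pow_sub_one hdvd)) ?_)
  have h : Nat.Coprime (q ^ s - 1) (q ^ s) := by
    have := Nat.coprime_self_add_right (m := q ^ s - 1) (n := 1)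
    rw [Nat.sub_add_cancel (Nat.one_le_pow _ _ (by omega))] at this
    exact this.2 (Nat.coprime_one_right _)
  exact h.coprime_dvd_right (dvd_pow_self q hs)

/-- Distinct monomials of the box have distinct weights. -/
theorem weight_lt_of_monLT (hq : 1 < q) (hs : s ≠ 0) (hdvd : u ∣ (q ^ s - 1) / (q - 1))
    {m m' : Fin 2 →₀ ℕ} (hm : m 1 < q ^ (s - 1)) (h : MonLT q s u m' m) :
    weight q s u m' < weight q s u m := by
  rcases h with h | ⟨h, hlt⟩
  · exact h
  exfalso
  unfold weight at h
  have h1 : m 0 * q ^ (s - 1) + u * (m 1 - m' 1) = m' 0 * q ^ (s - 1) := by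
    rw [Nat.mul_sub]
    have := Nat.mul_le_mul_left u hlt.le
    omega
  -- Since u is prime to q, equal weights make q^(s-1) divide the difference of the y-exponents,
  -- which is positive and less than q^(s-1).
  have h2 : q ^ (s - 1) ∣ u * (m 1 - m' 1) :=
    (Nat.dvd_add_right (Dvd.intro_left _ rfl)).1 (h1 ▸ Dvd.intro_left _ rfl)
  have h3 := (coprime_pow hq hs hdvd).symm.dvd_of_dvd_mul_left h2
  have := Nat.le_of_dvd (by omega) h3
  omega

/-- If `x^a y^b` is an initial monomial of a polynomial vanishing on `V`, so is `x^(a+u)`. -/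
theorem exists_initial_X_pow_add (hq : 1 < q) (hs : s ≠ 0) (hdvd : u ∣ (q ^ s - 1) / (q - 1))
    (hu : 0 < u) {V : Set (K × K)} (hV : V ⊆ curve K q s u) {f : MvPolynomial (Fin 2) K}
    (hf : f ∈ idealOf V) {m : Fin 2 →₀ ℕ} (hfm : IsInitial q s u f m)
    (hm : m 1 < q ^ (s - 1)) :
    ∃ g ∈ idealOf V, IsInitial q s u g (Finsupp.single 0 (m 0 + u)) := by
  set c := coeff m f with hc
  have hc0 : c ≠ 0 := mem_support_iff.1 hfm.1
  -- Strict inequality of weights is essential: x^(a+u) contains no y and would lose every tie.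
  have hf' : f - monomial m c ∈ polySpan K {m' | weight q s u m' < weight q s u m} :=
    sub_monomial_mem_polySpan fun m' hm' hne =>
      weight_lt_of_monLT hq hs hdvd hm (hfm.2 m' hm' hne)
  -- An S-polynomial: the terms c x^a y^(q^(s-1)) cancel, and c x^(a+u), of the same weight,
  -- survives from the term -x^u of the curve polynomial.
  refine ⟨monomial (Finsupp.single 1 (q ^ (s - 1) - m 1)) 1 * f -
    monomial (Finsupp.single 0 (m 0)) c *
      (∑ i ∈ Finset.range s, (X 1 : MvPolynomial (Fin 2) K) ^ q ^ i - X 0 ^ u),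
    sub_mem (Ideal.mul_mem_left _ _ hf) (Ideal.mul_mem_left _ _ (curvePolynomial_mem hV)), ?_⟩
  have hpow : (X 1 : MvPolynomial (Fin 2) K) ^ (q ^ (s - 1) - m 1) * X 1 ^ m 1 =
      X 1 ^ q ^ (s - 1) := by
    rw [← pow_add, Nat.sub_add_cancel hm.le]
  have e : monomial (Finsupp.single 1 (q ^ (s - 1) - m 1)) 1 * f -
      monomial (Finsupp.single 0 (m 0)) c *
        (∑ i ∈ Finset.range s, (X 1 : MvPolynomial (Fin 2) K) ^ q ^ i - X 0 ^ u) =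
      monomial (Finsupp.single 0 (m 0 + u)) c +
      (monomial (Finsupp.single 1 (q ^ (s - 1) - m 1)) 1 * (f - monomial m c) -
        ∑ i ∈ Finset.range (s - 1), monomial (Finsupp.single 0 (m 0)) c *
          monomial (Finsupp.single 1 (q ^ i)) 1) := by
    rw [← Finset.mul_sum]
    simp only [← X_pow_eq]
    rw [monomial_eq_C_mul m c, monomial_eq_C_mul (Finsupp.single 0 (m 0)) c,
      monomial_eq_C_mul (Finsupp.single 0 (m 0 + u)) c]
    have hr : ∑ i ∈ Finset.range s, (X 1 : MvPolynomial (Fin 2) K) ^ q ^ i =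
        ∑ i ∈ Finset.range (s - 1), X 1 ^ q ^ i + X 1 ^ q ^ (s - 1) := by
      obtain ⟨s, rfl⟩ := Nat.exists_eq_succ_of_ne_zero hs
      rw [Finset.sum_range_succ, Nat.succ_sub_one]
    rw [hr, ← hpow]
    simp
    ring
  rw [e]
  have hw : weight q s u (Finsupp.single 0 (m 0 + u)) =
      u * (q ^ (s - 1) - m 1) + weight q s u m := by
    have : u * (q ^ (s - 1) - m 1) + u * m 1 = u * q ^ (s - 1) := by
      rw [← mul_add, Nat.sub_add_cancel hm.le]
    simp only [weight, Finsupp.single_eq_same, add_mul, ← this]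
    simp
    ring
  refine (isInitial_monomial _ hc0).add_lower (sub_mem
    (monomial_mul_mem_polySpan hf' (fun m' hm' => ?_) 1) (sum_mem fun i hi => ?_))
  · left
    rw [hw]
    have : weight q s u m' < weight q s u m := hm'
    simp only [weight, Finsupp.add_apply] at this ⊢
    simp [mul_add]
    omega
  · refine monomial_mul_mem_polySpan (S := {Finsupp.single 1 (q ^ i)})
      (monomial_mem_polySpan rfl) ?_ c
    rintro _ rfl
    left
    have := Nat.mul_lt_mul_of_pos_left (Nat.pow_lt_pow_right hq (Finset.mem_range.1 hi)) hu
    simpa [weight, add_mul] using this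

/-- The common zeros on the curve of polynomials with initial monomials in `M` are at most
`|Δ*(M)|`. -/
theorem ncard_le_ncard_deltaStar [Fintype K] (hq : IsPrimePow q) (hs : s ≠ 0) (hK : Fintype.card K = q ^ s)
    (hu : 0 < u) (hdvd : u ∣ (q ^ s - 1) / (q - 1)) {V : Set (K × K)} (hV : V ⊆ curve K q s u)
    {M : Set (Fin 2 →₀ ℕ)} (hM : M.Nonempty) (hMbox : M ⊆ box K q s u)
    (hf : ∀ m ∈ M, ∃ f ∈ idealOf V, IsInitial q s u f m) :
    V.ncard ≤ (deltaStar K q s u M).ncard := by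
  refine ncard_le_of_footprint (q := q) (s := s) (u := u) V _
    ((box_finite K q s u).subset (deltaStar_subset_box K q s u M)) fun m hm => ?_
  rw [mem_deltaStar, not_and_or, not_and_or, not_lt, not_lt, min_le_iff] at hm
  -- A monomial leaves Δ*(M) past the y-bound, past a₁ + u, past u(q-1), or by being divisible by an
  -- element of M; each case has its own polynomial in the ideal of V.
  rcases hm with hm | (hm | hm) | hm
  · obtain ⟨g, hg, hgi⟩ := exists_initial_Y_pow hq.one_lt hs hu hV
    exact ⟨g, hg, _, hgi, Finsupp.single_le_iff.2 hm⟩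
  · obtain ⟨t, ht, hta⟩ := Nat.sInf_mem (hM.image fun m => m 0)
    obtain ⟨f, hf, hft⟩ := hf t ht
    obtain ⟨g, hg, hgi⟩ := exists_initial_X_pow_add hq.one_lt hs hdvd hu hV hf hft
      ((mem_box K).1 (hMbox ht)).2
    exact ⟨g, hg, _, hgi, Finsupp.single_le_iff.2 (by rw [← hta] at hm; exact hm)⟩
  · obtain ⟨g, hg, hgi⟩ := exists_initial_X_pow hq hs hK hu hV
    exact ⟨g, hg, _, hgi, Finsupp.single_le_iff.2 hm⟩
  · push Not at hm
    obtain ⟨t, ht, htm⟩ := hm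
    obtain ⟨f, hf, hft⟩ := hf t ht
    exact ⟨f, hf, t, hft, htm⟩

theorem span_evalOn_curve_eq_top [Fintype K] (hq : IsPrimePow q) (hs : s ≠ 0) (hK : Fintype.card K = q ^ s)
    (hu : 0 < u) :
    Submodule.span K (Set.range fun m : box K q s u =>
      evalOn (curve K q s u) (monomial m.1 (1 : K))) = ⊤ := by
  refine span_evalOn_eq_top (q := q) (s := s) (u := u) _ _ fun m hm => ?_
  rw [mem_box, not_and_or, not_lt, not_lt] at hm
  rcases hm with hm | hm
  · obtain ⟨g, hg, hgi⟩ := exists_initial_X_pow hq hs hK hu (le_refl (curve K q s u))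
    exact ⟨g, hg, _, hgi, Finsupp.single_le_iff.2 hm⟩
  · obtain ⟨g, hg, hgi⟩ := exists_initial_Y_pow hq.one_lt hs hu (le_refl (curve K q s u))
    exact ⟨g, hg, _, hgi, Finsupp.single_le_iff.2 hm⟩

/-- The evaluation map is injective on the span of the box. -/
theorem disjoint_polySpan_box_ker_ev [Fintype K] (hq : IsPrimePow q) (hs : s ≠ 0)
    (hK : Fintype.card K = q ^ s) (hu : 0 < u) (hdvd : u ∣ (q ^ s - 1) / (q - 1)) :
    Disjoint (polySpan K (box K q s u)) (LinearMap.ker (ev K q s u)) := by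
  classical
  have := (box_finite K q s u).fintype
  have hspan := span_evalOn_curve_eq_top hq hs hK hu
  -- Spanning gives one inequality and the point count the other, so the spanning family of
  -- evaluated monomials is a basis.
  have hcard : Fintype.card (box K q s u) = Module.finrank K (curve K q s u → K) := by
    have h1 := finrank_range_le_card (R := K) (fun m : box K q s u =>
      evalOn (curve K q s u) (monomial m.1 (1 : K)))
    rw [Set.finrank, hspan, finrank_top] at h1
    refine le_antisymm ?_ h1
    rw [Module.finrank_fintype_fun_eq_card, ← Nat.card_eq_fintype_card,
      ← Nat.card_eq_fintype_card]
    exact ncard_box_le_ncard_curve hq hs hK hu hdvd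
  have h : LinearIndependent K (ev K q s u ∘ fun m : box K q s u => monomial m.1 (1 : K)) :=
    linearIndependent_of_top_le_span_of_card_eq_finrank hspan.ge hcard
  have := Submodule.range_ker_disjoint h
  rwa [polySpan, monomials, Set.image_eq_range]

end Curve

end NormTrace
namespace NormTrace

open MvPolynomial

/-! ### Passing between subcodes and sets of initial monomials. -/

section Main

variable {K : Type*} [Field K] {q s u : ℕ}

theorem mem_codeSupport_compl {D : Submodule K (curve K q s u → K)} {P : curve K q s u} :
    P ∈ (codeSupport D)ᶜ ↔ ∀ c ∈ D, c P = 0 := by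
  simp [codeSupport]

theorem relInitials_subset {M₁ M₂ : Set (Fin 2 →₀ ℕ)} : relInitials K q s u M₁ M₂ ⊆ M₁ := by
  rintro m ⟨f, hf, -, hm⟩
  exact mem_polySpan.1 hf hm.1

theorem diff_subset_relInitials {M₁ M₂ : Set (Fin 2 →₀ ℕ)} :
    M₁ \ M₂ ⊆ relInitials K q s u M₁ M₂ := by
  classical
  rintro m ⟨h1, h2⟩
  refine ⟨monomial m 1, monomial_mem_polySpan h1, fun h => h2 ?_,
    isInitial_monomial m one_ne_zero⟩
  exact mem_polySpan.1 h (by simp [support_monomial])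

/-- A polynomial outside L(M₂) contains a monomial of M₁ \ M₂, which exceeds all of M₂, so its
initial monomial cannot lie in M₂. -/
theorem relInitials_eq_diff {M₁ M₂ : Set (Fin 2 →₀ ℕ)}
    (h : ∀ m ∈ M₁ \ M₂, ∀ m' ∈ M₂, MonLT q s u m' m) :
    relInitials K q s u M₁ M₂ = M₁ \ M₂ := by
  refine Set.Subset.antisymm ?_ diff_subset_relInitials
  rintro m ⟨f, hf, hf', hm⟩
  rw [mem_polySpan] at hf hf'
  refine ⟨hf hm.1, fun hm2 => ?_⟩
  obtain ⟨m', hm', hm'2⟩ := Set.not_subset.1 hf'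
  have h1 := h m' ⟨hf hm', hm'2⟩ m hm2
  exact MonLT.irrefl _ (h1.trans (hm.2 m' hm' (by rintro rfl; exact hm'2 hm2)))

theorem exists_isGreatest_deltaStarSizes {S : Set (Fin 2 →₀ ℕ)} {r : ℕ}
    (hr : r ≤ S.ncard) : ∃ d, IsGreatest (deltaStarSizes K q s u S r) d := by
  obtain ⟨M, hM, hMr⟩ := Set.exists_subset_card_eq hr
  have hbdd : BddAbove (deltaStarSizes K q s u S r) := by
    refine ⟨(box K q s u).ncard, ?_⟩
    rintro _ ⟨M, -, -, rfl⟩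
    exact Set.ncard_le_ncard (deltaStar_subset_box K q s u M) (box_finite K q s u)
  exact ⟨_, Nat.sSup_mem ⟨_, M, hM, hMr, rfl⟩ hbdd, fun k hk => le_csSup hbdd hk⟩

variable [Fintype K]

/-- From a subcode `D` to a set of initial monomials. -/
theorem exists_initials_of_subcode (hq : IsPrimePow q) (hs : s ≠ 0)
    (hK : Fintype.card K = q ^ s) (hu : 0 < u) (hdvd : u ∣ (q ^ s - 1) / (q - 1))
    {M₁ M₂ : Set (Fin 2 →₀ ℕ)} (hbox : M₁ ⊆ box K q s u) {r : ℕ} (hr : 1 ≤ r) {k : ℕ}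
    (hk : k ∈ relSupportSizes (code K q s u M₁) (code K q s u M₂) r) :
    ∃ M ⊆ relInitials K q s u M₁ M₂, M.ncard = r ∧
      (curve K q s u).ncard ≤ k + (deltaStar K q s u M).ncard := by
  obtain ⟨D, hD, hDr, hDC, rfl⟩ := hk
  set E := polySpan K M₁ ⊓ D.comap (ev K q s u) with hE
  have hmap : E.map (ev K q s u) = D := by
    refine le_antisymm ?_ fun d hd => ?_
    · rintro _ ⟨f, hf, rfl⟩
      exact hf.2
    · obtain ⟨f, hf, rfl⟩ := hD hd
      exact ⟨f, ⟨hf, hd⟩, rfl⟩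
  -- An element of `E` lying in L(M₂) evaluates into D ∩ ev(M₂) = {0}, hence is zero by injectivity
  -- and has no initial monomial.
  have hT : {m | ∃ f ∈ E, IsInitial q s u f m} ⊆ relInitials K q s u M₁ M₂ := by
    rintro m ⟨f, ⟨hf1, hfD⟩, hm⟩
    refine ⟨f, hf1, fun hf2 => hm.ne_zero ?_, hm⟩
    have h0 : ev K q s u f ∈ D ⊓ code K q s u M₂ := ⟨hfD, f, hf2, rfl⟩
    rw [hDC, Submodule.mem_bot] at h0
    exact Submodule.disjoint_def.1 (disjoint_polySpan_box_ker_ev hq hs hK hu hdvd) f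
      (polySpan_mono hbox hf1) h0
  have hTbox := (hT.trans relInitials_subset).trans hbox
  have hTfin := (box_finite K q s u).subset hTbox
  have := hTfin.fintype
  have hfinE : FiniteDimensional K E := by
    have h1 : E ≤ polySpan K (box K q s u) := inf_le_left.trans (polySpan_mono hbox)
    have : FiniteDimensional K (polySpan K (box K q s u)) :=
      FiniteDimensional.span_of_finite K ((box_finite K q s u).image _)
    exact Submodule.finiteDimensional_of_le h1
  have hrT : r ≤ {m | ∃ f ∈ E, IsInitial q s u f m}.ncard := by
    rw [← hDr, ← hmap]
    exact (Submodule.finrank_map_le _ _).trans (finrank_le_ncard_initials hq.pos E hTfin)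
  obtain ⟨M, hMT, hMr⟩ := Set.exists_subset_card_eq hrT
  refine ⟨M, hMT.trans hT, hMr, ?_⟩
  -- V consists of the positions at which all of `D` vanishes.
  have hle := ncard_le_ncard_deltaStar (V := Subtype.val '' (codeSupport D)ᶜ) (M := M)
    hq hs hK hu hdvd (Subtype.coe_image_subset _ _)
    (Set.nonempty_of_ncard_ne_zero (by omega)) (hMT.trans hTbox) (by
      intro m hm
      obtain ⟨f, hfE, hfm⟩ := hMT hm
      refine ⟨f, mem_idealOf.2 (funext ?_), hfm⟩
      rintro ⟨_, P, hP, rfl⟩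
      exact mem_codeSupport_compl.1 hP _ hfE.2)
  rw [Set.ncard_image_of_injective _ Subtype.val_injective] at hle
  have := Set.ncard_add_ncard_compl (codeSupport D)
  rw [Nat.card_coe_set_eq] at this
  omega

/-- From polynomials with distinct initial monomials to a subcode. -/
theorem exists_subcode_of_initials (hq : IsPrimePow q) (hs : s ≠ 0)
    (hK : Fintype.card K = q ^ s) (hu : 0 < u) (hdvd : u ∣ (q ^ s - 1) / (q - 1))
    {M₁ M₂ : Set (Fin 2 →₀ ℕ)} (h₂₁ : M₂ ⊆ M₁) (hbox : M₁ ⊆ box K q s u)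
    {M : Set (Fin 2 →₀ ℕ)} (hM : M ⊆ M₁ \ M₂)
    {V : Set (K × K)} (hV : V ⊆ curve K q s u) {f : (Fin 2 →₀ ℕ) → MvPolynomial (Fin 2) K}
    (hf : ∀ m ∈ M, f m ∈ polySpan K M₁ ∧ IsInitial q s u (f m) m ∧ f m ∈ idealOf V) :
    ∃ k ∈ relSupportSizes (code K q s u M₁) (code K q s u M₂) M.ncard,
      k + V.ncard ≤ (curve K q s u).ncard := by
  classical
  have hMfin : M.Finite := (box_finite K q s u).subset ((hM.trans Set.sdiff_subset).trans hbox)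
  have := hMfin.fintype
  have hinj := Submodule.disjoint_def.1 (disjoint_polySpan_box_ker_ev hq hs hK hu hdvd)
  -- A nontrivial combination has its initial monomial in M. This yields both the independence of
  -- the evaluations and, as M avoids M₂, the trivial intersection with ev(M₂).
  have hcomb (c : (Fin 2 →₀ ℕ) → K) :
      ∑ m ∈ M.toFinset, c m • f m ∈ polySpan K M₁ ∧
        ((∀ m ∈ M, c m = 0) ∨ ∃ m ∈ M, IsInitial q s u (∑ m ∈ M.toFinset, c m • f m) m) := by
    refine ⟨sum_mem fun m hm => Submodule.smul_mem _ _ (hf m (by simpa using hm)).1, ?_⟩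
    rcases (M.toFinset.filter fun m => c m ≠ 0).eq_empty_or_nonempty with h | h
    · left
      intro m hm
      by_contra hne
      have : m ∈ M.toFinset.filter fun m => c m ≠ 0 := by simp [hm, hne]
      simp [h] at this
    · right
      obtain ⟨m, hm, hmi⟩ := exists_isInitial_sum (s := s) (u := u) hq.pos (f := f) _ h
        (fun m hm => (hf m (by simpa using (Finset.mem_filter.1 hm).1)).2.1) (c := c)
        (fun m hm => (Finset.mem_filter.1 hm).2)
      refine ⟨m, by simpa using (Finset.mem_filter.1 hm).1, ?_⟩
      rwa [Finset.sum_filter_of_ne] at hmi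
      intro m _ hne hc
      simp [hc] at hne
  have hli : LinearIndependent K fun m : M => ev K q s u (f m.1) := by
    rw [Fintype.linearIndependent_iff]
    intro c hc
    let c' : (Fin 2 →₀ ℕ) → K := fun m => if h : m ∈ M then c ⟨m, h⟩ else 0
    have hsum : ev K q s u (∑ m ∈ M.toFinset, c' m • f m) = 0 := by
      rw [← hc, map_sum, ← Finset.sum_coe_sort M.toFinset]
      refine Fintype.sum_equiv (Equiv.subtypeEquivRight fun m => Set.mem_toFinset) _ _ ?_
      rintro ⟨m, hm⟩
      have hm' : m ∈ M := by simpa using hm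
      simp [c', hm']
      rfl
    obtain ⟨h1, h2⟩ := hcomb c'
    rcases h2 with h2 | ⟨m, -, hmi⟩
    · rintro ⟨m, hm⟩
      simpa [c', hm] using h2 m hm
    · exact absurd (hinj _ (polySpan_mono hbox h1) hsum) hmi.ne_zero
  set D := Submodule.span K (Set.range fun m : M => ev K q s u (f m.1)) with hD
  have hmemD {d : curve K q s u → K} (hd : d ∈ D) : ∃ c : (Fin 2 →₀ ℕ) → K,
      d = ev K q s u (∑ m ∈ M.toFinset, c m • f m) := by
    obtain ⟨c, rfl⟩ := (Submodule.mem_span_range_iff_exists_fun K).1 hd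
    refine ⟨fun m => if h : m ∈ M then c ⟨m, h⟩ else 0, ?_⟩
    rw [map_sum, ← Finset.sum_coe_sort M.toFinset]
    refine Fintype.sum_equiv (Equiv.subtypeEquivRight fun m => Set.mem_toFinset.symm) _ _ ?_
    rintro ⟨m, hm⟩
    simp [hm]
  refine ⟨(codeSupport D).ncard, ⟨D, ?_, ?_, ?_, rfl⟩, ?_⟩
  · rw [hD, Submodule.span_le]
    rintro _ ⟨m, rfl⟩
    exact ⟨_, (hf m.1 m.2).1, rfl⟩
  · rw [hD, finrank_span_eq_card hli, ← Nat.card_eq_fintype_card, Nat.card_coe_set_eq]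
  · rw [eq_bot_iff]
    rintro d ⟨hd, g, hg, hgd⟩
    obtain ⟨c, rfl⟩ := hmemD hd
    obtain ⟨h1, h2⟩ := hcomb c
    have h0 := hinj _ (polySpan_mono hbox (sub_mem (polySpan_mono h₂₁ hg) h1))
      (by rw [LinearMap.mem_ker, map_sub, hgd, sub_self])
    rw [sub_eq_zero] at h0
    rcases h2 with h2 | ⟨m, hm, hmi⟩
    · rw [Finset.sum_eq_zero fun m hm => by rw [h2 m (by simpa using hm), zero_smul], map_zero]
      exact zero_mem _
    · rw [← h0] at hmi
      exact absurd (mem_polySpan.1 hg hmi.1) (hM hm).2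
  · have hsub : V ⊆ Subtype.val '' (codeSupport D)ᶜ := by
      intro P hP
      refine ⟨⟨P, hV hP⟩, mem_codeSupport_compl.2 fun d hd => ?_, rfl⟩
      obtain ⟨c, rfl⟩ := hmemD hd
      have : ∑ m ∈ M.toFinset, c m • f m ∈ idealOf V := sum_mem fun m hm => by
        rw [smul_eq_C_mul]
        exact Ideal.mul_mem_left _ _ (hf m (by simpa using hm)).2.2
      exact congrFun (mem_idealOf.1 this) ⟨P, hP⟩
    have h1 := Set.ncard_le_ncard hsub (Set.toFinite _)
    rw [Set.ncard_image_of_injective _ Subtype.val_injective] at h1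
    have := Set.ncard_add_ncard_compl (codeSupport D)
    rw [Nat.card_coe_set_eq] at this
    omega

omit [Fintype K] in
theorem isInitial_of_sub_monomial_mem (hq : 0 < q) (hu : 0 < u) {f : MvPolynomial (Fin 2) K}
    {m : Fin 2 →₀ ℕ} (h : f - monomial m 1 ∈ polySpan K (Set.Iio m)) :
    f ∈ polySpan K (Set.Iic m) ∧ IsInitial q s u f m := by
  have h' : f - monomial m 1 ∈ polySpan K {m' | MonLT q s u m' m} :=
    polySpan_mono (fun n (hn : n < m) => monLT_of_lt hq hu hn) h
  rw [← add_sub_cancel (monomial m 1) f]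
  exact ⟨add_mem (monomial_mem_polySpan (Set.mem_Iic.2 le_rfl))
    (polySpan_mono Set.Iio_subset_Iic_self h), (isInitial_monomial m one_ne_zero).add_lower h'⟩

/-- Products of linear factors with prescribed initial monomials having `|Δ*(M)|` common zeros
on the curve. -/
theorem exists_polynomials_with_zeros (hq : IsPrimePow q) (hs : s ≠ 0)
    (hK : Fintype.card K = q ^ s) (hu : 0 < u) (hdvd : u ∣ (q ^ s - 1) / (q - 1))
    (M : Set (Fin 2 →₀ ℕ)) :
    ∃ V ⊆ curve K q s u, V.ncard = (deltaStar K q s u M).ncard ∧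
      ∃ f : (Fin 2 →₀ ℕ) → MvPolynomial (Fin 2) K, ∀ m ∈ M,
        f m ∈ polySpan K (Set.Iic m) ∧ IsInitial q s u (f m) m ∧ f m ∈ idealOf V := by
  -- The window with x^u = 1 starts at a₁, the smallest x-exponent in M.
  obtain ⟨x, hx, hxq, hx1⟩ := exists_abscissa_enum hq.one_lt hK hu hdvd
    (sInf ((fun m : Fin 2 →₀ ℕ => m 0) '' M))
  obtain ⟨y, hy⟩ := exists_trace_fiber_enum hq hs hK
  have hbox (m) (hm : m ∈ deltaStar K q s u M) := (mem_box K).1 (deltaStar_subset_box K q s u M hm)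
  -- V is a copy of Δ*(M) under the enumeration of the points; the y-factors use only the trace
  -- fibre over 1.
  refine ⟨(fun m => (x (m 0), y (x (m 0) ^ u) (m 1))) '' deltaStar K q s u M, ?_,
    Set.InjOn.ncard_image ?_, fun m => (∏ i ∈ Finset.range (m 0), (X 0 - C (x i) : MvPolynomial (Fin 2) K)) *
      ∏ j ∈ Finset.range (m 1), (X 1 - C (y 1 j)), fun m hm => ?_⟩
  · rintro _ ⟨m, hm, rfl⟩
    exact ((hy _ (hxq _ (hbox m hm).1)).2 _ (hbox m hm).2).symm
  · intro m hm m' hm' h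
    obtain ⟨h0, h1⟩ := Prod.mk.inj h
    have e0 := hx (hbox m hm).1 (hbox m' hm').1 h0
    rw [e0] at h1
    have e1 := (hy _ (hxq _ (hbox m' hm').1)).1 (hbox m hm).2 (hbox m' hm').2 h1
    ext i
    fin_cases i <;> assumption
  · beta_reduce
    have hlow := prod_linear_factors_sub_mem x (y 1) (m 0) (m 1)
    have e : Finsupp.single 0 (m 0) + Finsupp.single 1 (m 1) = m := expVec_apply m
    rw [e] at hlow
    set p := (∏ i ∈ Finset.range (m 0), (X 0 - C (x i) : MvPolynomial (Fin 2) K)) *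
      ∏ j ∈ Finset.range (m 1), (X 1 - C (y 1 j)) with hp
    obtain ⟨hp1, hp2⟩ := isInitial_of_sub_monomial_mem (s := s) hq.pos hu hlow
    refine ⟨hp1, hp2, ?_⟩
    · rw [mem_idealOf]
      funext P
      obtain ⟨n, hn, hnP⟩ := P.2
      have hn' := (mem_deltaStar K).1 hn
      rw [evalOn_apply, ← hnP, hp, map_mul, map_prod, map_prod, Pi.zero_apply, mul_eq_zero,
        Finset.prod_eq_zero_iff, Finset.prod_eq_zero_iff]
      -- As m does not divide n, one exponent of n is smaller than that of m. If it is not that of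
      -- x, then n 0 ≥ a₁ lies in the window and the ordinate belongs to the fibre over 1.
      by_cases h0 : n 0 < m 0
      · left
        exact ⟨n 0, Finset.mem_range.2 h0, by simp⟩
      right
      have h1 : n 1 < m 1 := by
        by_contra h1
        refine hn'.2.2 m hm fun i => ?_
        fin_cases i
        · exact not_lt.1 h0
        · exact not_lt.1 h1
      have ha : sInf ((fun m : Fin 2 →₀ ℕ => m 0) '' M) ≤ m 0 := Nat.sInf_le ⟨m, hm, rfl⟩
      refine ⟨n 1, Finset.mem_range.2 h1, ?_⟩
      simp [hx1 (n 0) (ha.trans (not_lt.1 h0)) hn'.2.1]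

end Main

end NormTrace

/-! ### The bound and the case of equality. -/

theorem theorem5p2 {K : Type*} [Field K] [Fintype K] (q s u : ℕ)
    (hq : IsPrimePow q) (hs : 2 ≤ s) (hK : Fintype.card K = q ^ s)
    (hu : 0 < u) (hdvd : u ∣ (q ^ s - 1) / (q - 1))
    (M₁ M₂ : Set (Fin 2 →₀ ℕ)) (h₁ : IsLowerSet M₁) (h₂ : IsLowerSet M₂)
    (h₂₁ : M₂ ⊆ M₁) (hbox : M₁ ⊆ NormTrace.box K q s u)
    (r : ℕ) (hr : 1 ≤ r) (hr' : r ≤ M₁.ncard - M₂.ncard) :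
    -- the minimum defining `M_r(ev(M₁), ev(M₂))` is attained
    IsLeast
      (NormTrace.relSupportSizes (NormTrace.code K q s u M₁) (NormTrace.code K q s u M₂) r)
      (NormTrace.relGHW (NormTrace.code K q s u M₁) (NormTrace.code K q s u M₂) r) ∧
    -- the lower bound
    (∃ d : ℕ,
      IsGreatest (NormTrace.deltaStarSizes K q s u (NormTrace.relInitials K q s u M₁ M₂) r) d ∧
      (NormTrace.relGHW (NormTrace.code K q s u M₁) (NormTrace.code K q s u M₂) r : ℤ) ≥
        ((NormTrace.curve K q s u).ncard : ℤ) - (d : ℤ)) ∧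
    -- equality
    ((∀ m ∈ M₁ \ M₂, ∀ m' ∈ M₂, NormTrace.MonLT q s u m' m) →
      ∃ d : ℕ,
        IsGreatest (NormTrace.deltaStarSizes K q s u (M₁ \ M₂) r) d ∧
        (NormTrace.relGHW (NormTrace.code K q s u M₁) (NormTrace.code K q s u M₂) r : ℤ) =
          ((NormTrace.curve K q s u).ncard : ℤ) - (d : ℤ)) := by
  have hs0 : s ≠ 0 := by omega
  have hM₁ : M₁.Finite := (NormTrace.box_finite K q s u).subset hbox
  have hcard : r ≤ (M₁ \ M₂).ncard := by
    rwa [Set.ncard_sdiff h₂₁ (hM₁.subset h₂₁)]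
  have hne : (NormTrace.relSupportSizes (NormTrace.code K q s u M₁) (NormTrace.code K q s u M₂) r).Nonempty := by
    obtain ⟨M, hM, rfl⟩ := Set.exists_subset_card_eq hcard
    -- With no zeros prescribed, the monomials of M themselves give an admissible subcode.
    obtain ⟨k, hk, -⟩ := NormTrace.exists_subcode_of_initials (V := ∅) (f := fun m => MvPolynomial.monomial m 1)
      hq hs0 hK hu hdvd h₂₁ hbox hM (Set.empty_subset _) fun m hm =>
        ⟨NormTrace.monomial_mem_polySpan (hM hm).1, NormTrace.isInitial_monomial m one_ne_zero,
          NormTrace.mem_idealOf.2 (funext fun P => P.2.elim)⟩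
    exact ⟨k, hk⟩
  have hmem : NormTrace.relGHW (NormTrace.code K q s u M₁) (NormTrace.code K q s u M₂) r ∈
      NormTrace.relSupportSizes (NormTrace.code K q s u M₁) (NormTrace.code K q s u M₂) r := Nat.sInf_mem hne
  have hle : r ≤ (NormTrace.relInitials K q s u M₁ M₂).ncard :=
    hcard.trans (Set.ncard_le_ncard NormTrace.diff_subset_relInitials (hM₁.subset NormTrace.relInitials_subset))
  obtain ⟨d, hd⟩ := NormTrace.exists_isGreatest_deltaStarSizes (K := K) (q := q) (s := s) (u := u)
    hle
  have hlower : (NormTrace.curve K q s u).ncard ≤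
      NormTrace.relGHW (NormTrace.code K q s u M₁) (NormTrace.code K q s u M₂) r + d := by
    obtain ⟨M, hM, hMr, h⟩ := NormTrace.exists_initials_of_subcode hq hs0 hK hu hdvd hbox hr hmem
    exact h.trans (Nat.add_le_add_left (hd.2 ⟨M, hM, hMr, rfl⟩) _)
  refine ⟨⟨hmem, fun k hk => Nat.sInf_le hk⟩, ⟨d, hd, by omega⟩, fun horder => ?_⟩
  rw [NormTrace.relInitials_eq_diff horder] at hd
  refine ⟨d, hd, ?_⟩
  obtain ⟨M, hM, hMr, hMd⟩ := hd.1
  obtain ⟨V, hV, hVcard, f, hf⟩ := NormTrace.exists_polynomials_with_zeros hq hs0 hK hu hdvd M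
  -- Here M attains the maximum. As M₁ is decreasing, it contains every divisor of each m in M, so
  -- the products lie in L(M₁).
  obtain ⟨k, hk, hkV⟩ := NormTrace.exists_subcode_of_initials hq hs0 hK hu hdvd h₂₁ hbox hM hV
    (f := f) fun m hm => ⟨NormTrace.polySpan_mono (fun _ h => h₁ h (hM hm).1) (hf m hm).1, (hf m hm).2⟩
  rw [hMr] at hk
  have hupper : NormTrace.relGHW (NormTrace.code K q s u M₁) (NormTrace.code K q s u M₂) r ≤ k := Nat.sInf_le hk
  omega
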